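/- Let $[n]=\{1,\dots,n\}$. For a family $\mathcal F$ of subsets of $[n]$, let its diversity be $\gamma(\mathcal F)=|\mathcal F|-\max_{i\in[n]}|\{F\in\mathcal F: i\in F\}|$. $\mathcal F$ is intersecting if any two of its members have a common element. For $i<j$ let the $(i,j)$-shift $S_{i,j}(A)$ of a set $A$ be $(A\setminus\{j\})\cup\{i\}$ if $j\in A$, $i\notin A$, and $A$ otherwise; $\mathcal F$ is shifted if $\{S_{i,j}(A):A\in\mathcal F\}\cup\{A\in\mathcal F:S_{i,j}(A)\in\mathcal F\}=\mathcal F$ for all $1\le i<j\le n$. For $r\ge 0$ let $$\mathcal D_r=\Big\{D\in\tbinom{[n]}{k}: |D\cap[2r+1]|\ge r+1\Big\}.$$ Arrange $J=[2r+1]$ in its natural order on a circle. For $S\subseteq J$ let $\mathbf u(S)$ be the sequence of lengths of the maximal runs of consecutive elements of $S$ on the circle, in non-increasing order, and $\mathbf z(S)=\mathbf u(J\setminus S)$ the same sequence for the non-elements (if $S=J$ there is one run, of length $2r+1$). Let $\mathcal T_r$ be the family of all $T\in\binom{[n]}{k}$ such that $\mathbf u(T\cap J)$ is lexicographically larger than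 $\mathbf z(T\cap J)$, where sequences are padded with zeros. For $s\ge 0$ let $R_s$ be the set of pairs $(n,k)$ with $$(k-1)\Big(2+\frac1{s+1}\Big)+1\le n\le (k-1)\Big(2+\frac1s\Big)+1$$ (with no upper bound if $s=0$). 1. There is $r_0$ such that for every $r\ge r_0$ there are $k_0=k_0(r)$ and $n_0=n_0(r)$ such that for all $k\ge k_0$ and $n\ge n_0$ with $(n,k)\in R_r\cup R_{r-1}$ (where $R_{r-1}$ is taken as empty if $r=0$), the family $\mathcal T_r$ is intersecting, is not shifted, and satisfies $$\gamma(\mathcal D_r)<\gamma(\mathcal T_r).$$ 2. Consequently, for neither $d=0$ nor $d=1$ is the following true: whenever $2k<n<3k$, $s\ge1$ and $(n,k)\in R_s$, every intersecting family $\mathcal F\subset\binom{[n]}{k}$ satisfies $\gamma(\mathcal F)\le\gamma(\mathcal D_{s+d})$. -/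

import Mathlib

/-- The ground set `[n]` is modelled by `Fin n`, and a family of subsets of `[n]` by a
`Finset (Finset (Fin n))`. The degree of `i` in `F` is the number of members containing `i`. -/
def degree {n : ℕ} (F : Finset (Finset (Fin n))) (i : Fin n) : ℕ :=
  (F.filter (fun A => i ∈ A)).card

/-- The largest degree of an element of the ground set. -/
def maxDegree {n : ℕ} (F : Finset (Finset (Fin n))) : ℕ :=
  Finset.univ.sup (degree F)

/-- The diversity `γ(F) = |F| - Δ(F)`. The subtraction does not truncate, as `Δ(F) ≤ |F|`. -/
def diversity {n : ℕ} (F : Finset (Finset (Fin n))) : ℕ :=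
  F.card - maxDegree F

/-- Any two members of the family (equal ones included) have a common element. -/
def IsIntersectingFamily {n : ℕ} (F : Finset (Finset (Fin n))) : Prop :=
  ∀ A ∈ F, ∀ B ∈ F, (A ∩ B).Nonempty

/-- The `(i,j)`-shift of a set: replace `j` by `i` if `j ∈ A` and `i ∉ A`. -/
def shiftSet {n : ℕ} (i j : Fin n) (A : Finset (Fin n)) : Finset (Fin n) :=
  if j ∈ A ∧ i ∉ A then insert i (A.erase j) else A

/-- The `(i,j)`-shift of a family. -/
def shiftFamily {n : ℕ} (i j : Fin n) (F : Finset (Finset (Fin n))) :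
    Finset (Finset (Fin n)) :=
  F.image (shiftSet i j) ∪ F.filter (fun A => shiftSet i j A ∈ F)

/-- A family is shifted if it is fixed by all `(i,j)`-shifts with `i < j`. -/
def IsShiftedFamily {n : ℕ} (F : Finset (Finset (Fin n))) : Prop :=
  ∀ i j : Fin n, i < j → shiftFamily i j F = F

/-- The "`r+1` out of `2r+1`" family of `k`-subsets of `[n]`. The first `2r+1` elements of the
ground set are those whose value is less than `2r+1`. -/
def familyD (n k r : ℕ) : Finset (Finset (Fin n)) :=
  (Finset.powersetCard k Finset.univ).filter
    (fun A => r + 1 ≤ (A.filter (fun i : Fin n => (i : ℕ) < 2 * r + 1)).card)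

/-- The multiset of lengths of the runs of a subset `S` of the circle `ZMod m`. A run of length
`l < m` starting at `i` is a maximal block `i, i+1, …, i+l-1` of elements of `S`: the points `i-1`
and `i+l` are not in `S`. If `S` is the whole circle, there is one run, of length `m`. -/
def runLengths (m : ℕ) [NeZero m] (S : Finset (ZMod m)) : Multiset ℕ :=
  if S = Finset.univ then {m}
  else ((Finset.univ ×ˢ Finset.Ico 1 m : Finset (ZMod m × ℕ)).filter
    (fun q => q.1 - 1 ∉ S ∧ (∀ j ∈ Finset.range q.2, q.1 + (j : ZMod m) ∈ S) ∧
      q.1 + (q.2 : ZMod m) ∉ S)).val.map Prod.snd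

/-- The run lengths of `S`, listed from the longest to the shortest. -/
def runSequence (m : ℕ) [NeZero m] (S : Finset (ZMod m)) : List ℕ :=
  (runLengths m S).sort (fun a b => b ≤ a)

/-- The sequence of runs of elements of `S` is lexicographically bigger than the sequence of runs
of non-elements of `S`. In the order `<` on lists a proper initial segment is smaller, which is the
order obtained by padding the sequences with zeros. -/
def RunsDominate (m : ℕ) [NeZero m] (S : Finset (ZMod m)) : Prop :=
  runSequence m Sᶜ < runSequence m S

instance (m : ℕ) [NeZero m] (S : Finset (ZMod m)) : Decidable (RunsDominate m S) :=
  inferInstanceAs (Decidable (_ < _))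

/-- The trace of `A ⊆ [n]` on the first `2r+1` elements of `[n]`, which are arranged in their
natural order on the circle `ZMod (2r+1)`. -/
def circleTrace {n : ℕ} (r : ℕ) (A : Finset (Fin n)) : Finset (ZMod (2 * r + 1)) :=
  Finset.univ.filter (fun x => ∃ i ∈ A, (i : ℕ) = x.val)

/-- The cyclic-runs junta: the `k`-subsets of `[n]` whose trace on the first `2r+1` elements,
arranged on a circle, has its runs of ones lexicographically dominating its runs of zeros. -/
def familyT (n k r : ℕ) : Finset (Finset (Fin n)) :=
  (Finset.powersetCard k Finset.univ).filter
    (fun A => RunsDominate (2 * r + 1) (circleTrace r A))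

/-- The range `(k-1)(2+1/(s+1))+1 ≤ n ≤ (k-1)(2+1/s)+1`, the upper bound being absent for
`s = 0`. -/
def InAKRange (n k s : ℕ) : Prop :=
  ((k : ℝ) - 1) * (2 + 1 / ((s : ℝ) + 1)) + 1 ≤ (n : ℝ) ∧
    (s = 0 ∨ (n : ℝ) ≤ ((k : ℝ) - 1) * (2 + 1 / (s : ℝ)) + 1)

/-- The naive conjecture for `2k < n < 3k`: if `n` lies in the range with index `s ≥ 1`, then every
intersecting family of `k`-subsets of `[n]` has diversity at most that of the "`r+1` out of `2r+1`"
family with `r = s + d`. The indexing coming from the Ahlswede–Khachatrian theorem for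
`2`-intersecting families on `n - 1` points is `d = 1`; for `d = 0` the range and the family carry
the same index. -/
def NaiveConjecture (d : ℕ) : Prop :=
  ∀ n k s : ℕ, 2 * k < n → n < 3 * k → 1 ≤ s → InAKRange n k s →
    ∀ F : Finset (Finset (Fin n)), (∀ A ∈ F, A.card = k) → IsIntersectingFamily F →
      diversity F ≤ diversity (familyD n k (s + d))

/-! Write m = 2r+1. Both families are juntas: membership depends only on the trace on the circle.
Two facts about traces carry the proof.

First, the run sequence is monotone under inclusion (`runSequence_mono`). If dominating traces S, S'
were disjoint, then u(S) ≤ z(S') < u(S') ≤ z(S) < u(S), which is absurd; so the family is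
intersecting. Second, m is odd, so u(S) and z(S) have different sums and exactly one of S, Sᶜ
dominates. Hence `familyT` picks one trace from each complementary pair, while `familyD` always
picks the larger one. For r ≥ 5 the choices differ somewhere (`exists_runsDominate_card_le`).

Diversity is the minimum over points i of the number of members avoiding i, so it suffices to
compare these numbers for each i. For i off the circle, a trace of size j has weight C(n-m-1, k-j).
For i on the circle, rotation invariance allows averaging over the circle, giving weight
proportional to (m-j)·C(n-m, k-j). Once n ≥ 2k+2, both weights are strictly larger at m-j than at j
for every j > r, so taking the smaller set of a pair gains, and `familyT` wins at every point.

The family is not shifted because shifting would push a dominating trace of size at most r to an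
initial segment, which fits into its own complement after a rotation and so cannot dominate. -/

/-! ### Lexicographic comparison through multiplicities -/

/-- For descending lists, having more copies of the largest value whose multiplicities differ
makes a list lexicographically larger. -/
theorem List.lt_of_count_lt {t : ℕ} : ∀ {l l' : List ℕ}, l.Pairwise (fun a b => b ≤ a) →
    l'.Pairwise (fun a b => b ≤ a) → (∀ a, t < a → l.count a = l'.count a) →
    l.count t < l'.count t → l < l'
  | _, [], _, _, _, h => by simp at h
  | [], _ :: _, _, _, _, _ => List.nil_lt_cons _ _
  | a :: l, b :: l', hl, hl', heq, hlt => by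
    rw [List.cons_lt_cons_iff]
    rw [List.pairwise_cons] at hl hl'
    rcases lt_trichotomy a b with h | rfl | h
    · exact Or.inl h
    · refine Or.inr ⟨rfl, List.lt_of_count_lt (t := t) hl.2 hl'.2 (fun c hc => ?_) ?_⟩
      · simpa [List.count_cons] using heq c hc
      · simpa [List.count_cons] using hlt
    -- Some value exceeding `b` would occur in `b :: l'`: it is `a` if `t < a`, and `t` otherwise.
    · exfalso
      have hb : ∀ c ∈ b :: l', c ≤ b := by
        intro c hc
        rcases List.mem_cons.1 hc with rfl | hc
        exacts [le_rfl, hl'.1 c hc]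
      rcases lt_or_ge t a with hta | hta
      · have h1 : 0 < (b :: l').count a := by
          rw [← heq a hta]; simp
        have := hb a (List.count_pos_iff.1 h1)
        omega
      · have := hb t (List.count_pos_iff.1 (by omega))
        omega

theorem Multiset.sort_lt_sort_of_count_lt {M M' : Multiset ℕ} {t : ℕ}
    (heq : ∀ a, t < a → M.count a = M'.count a) (hlt : M.count t < M'.count t) :
    M.sort (fun a b => b ≤ a) < M'.sort (fun a b => b ≤ a) := by
  refine List.lt_of_count_lt (t := t) (M.pairwise_sort _) (M'.pairwise_sort _) ?_ ?_
  · intro a ha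
    rw [← Multiset.coe_count, ← Multiset.coe_count, Multiset.sort_eq, Multiset.sort_eq, heq a ha]
  · rwa [← Multiset.coe_count, ← Multiset.coe_count, Multiset.sort_eq, Multiset.sort_eq]

theorem Multiset.sort_lt_sort_of_forall_lt {M M' : Multiset ℕ} {b : ℕ} (hb : b ∈ M')
    (h : ∀ a ∈ M, a < b) : M.sort (fun a b => b ≤ a) < M'.sort (fun a b => b ≤ a) := by
  obtain ⟨c, hc, hmax⟩ := M'.toFinset.exists_max_image id ⟨b, by simpa using hb⟩
  simp only [Multiset.mem_toFinset, id] at hc hmax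
  have h0 : ∀ a, c ≤ a → M.count a = 0 := fun a ha =>
    Multiset.count_eq_zero.2 fun hM => by have := h a hM; have := hmax b hb; omega
  refine Multiset.sort_lt_sort_of_count_lt (t := c) (fun a ha => ?_) ?_
  · rw [h0 a ha.le, Multiset.count_eq_zero.2]
    intro hM'
    have := hmax a hM'
    omega
  · rw [h0 c le_rfl]
    exact Multiset.count_pos.2 hc

/-! ### Runs on the circle and monotonicity of the run sequence -/

section Runs

variable {m : ℕ}

/-- The rotation of a subset of the circle. -/
def rotate (c : ZMod m) (S : Finset (ZMod m)) : Finset (ZMod m) :=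
  S.map (Equiv.addRight c).toEmbedding

@[simp]
theorem mem_rotate {c x : ZMod m} {S : Finset (ZMod m)} : x ∈ rotate c S ↔ x - c ∈ S := by
  rw [rotate, Finset.mem_map_equiv]
  simp [sub_eq_add_neg]

@[simp]
theorem card_rotate (c : ZMod m) (S : Finset (ZMod m)) : (rotate c S).card = S.card :=
  Finset.card_map _

variable [NeZero m]

/-- The runs of a proper subset of the circle, as pairs of a starting point and a length. -/
def runs (S : Finset (ZMod m)) : Finset (ZMod m × ℕ) :=
  (Finset.univ ×ˢ Finset.Ico 1 m : Finset (ZMod m × ℕ)).filter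
    (fun q => q.1 - 1 ∉ S ∧ (∀ j ∈ Finset.range q.2, q.1 + (j : ZMod m) ∈ S) ∧
      q.1 + (q.2 : ZMod m) ∉ S)

theorem mem_runs {S : Finset (ZMod m)} {q : ZMod m × ℕ} :
    q ∈ runs S ↔ (1 ≤ q.2 ∧ q.2 < m) ∧ q.1 - 1 ∉ S ∧
      (∀ j < q.2, q.1 + (j : ZMod m) ∈ S) ∧ q.1 + (q.2 : ZMod m) ∉ S := by
  simp [runs]

theorem runLengths_of_ne_univ {S : Finset (ZMod m)} (hS : S ≠ Finset.univ) :
    runLengths m S = (runs S).val.map Prod.snd := by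
  rw [runLengths, if_neg hS, runs]

theorem mem_runLengths {S : Finset (ZMod m)} (hS : S ≠ Finset.univ) {a : ℕ} :
    a ∈ runLengths m S ↔ ∃ q ∈ runs S, q.2 = a := by
  rw [runLengths_of_ne_univ hS, Multiset.mem_map]
  rfl

theorem count_runLengths {S : Finset (ZMod m)} (hS : S ≠ Finset.univ) (a : ℕ) :
    (runLengths m S).count a = ((runs S).filter (fun q => q.2 = a)).card := by
  rw [runLengths_of_ne_univ hS, Multiset.count_map, Finset.card_def, Finset.filter_val]
  simp only [eq_comm]

/-- Two runs sharing a point are equal. -/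
theorem runs_unique {S : Finset (ZMod m)} {q q' : ZMod m × ℕ} (hq : q ∈ runs S)
    (hq' : q' ∈ runs S) {d d' : ℕ} (hd : d < q.2) (hd' : d' < q'.2)
    (h : q.1 + (d : ZMod m) = q'.1 + (d' : ZMod m)) : q = q' := by
  wlog hle : d ≤ d' generalizing q q' d d'
  · exact (this hq' hq hd' hd h.symm (by omega)).symm
  obtain ⟨-, h1, h2, h3⟩ := mem_runs.1 hq
  obtain ⟨-, h1', h2', h3'⟩ := mem_runs.1 hq'
  obtain ⟨e, rfl⟩ := Nat.exists_eq_add_of_le hle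
  have hqe : q.1 = q'.1 + (e : ZMod m) := by
    push_cast at h
    linear_combination h
  -- With equal starts, the shorter run's missing endpoint would lie in the longer run. Otherwise
  -- the point just before `q` lies inside `q'`.
  rcases e with _ | e
  · have hfst : q.1 = q'.1 := by simpa using hqe
    refine Prod.ext hfst (le_antisymm ?_ ?_) <;> by_contra! hlt
    · exact h3' (hfst ▸ h2 _ hlt)
    · exact h3 (hfst ▸ h2' _ hlt)
  · refine absurd ?_ h1
    have : q.1 - 1 = q'.1 + (e : ZMod m) := by rw [hqe]; push_cast; ring
    rw [this]
    exact h2' e (by omega)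

/-- Every arc inside a proper subset of the circle lies in a run of it. -/
theorem exists_run {B : Finset (ZMod m)} (hB : B ≠ Finset.univ) {i : ZMod m} {t : ℕ}
    (ht : 1 ≤ t) (h : ∀ j < t, i + (j : ZMod m) ∈ B) :
    ∃ q ∈ runs B, ∃ d : ℕ, i = q.1 + (d : ZMod m) ∧ d + t ≤ q.2 := by
  obtain ⟨y, hy⟩ : ∃ y, y ∉ B := by
    by_contra! hc
    exact hB (Finset.eq_univ_iff_forall.2 hc)
  have hleft : ∃ d : ℕ, i - ((d + 1 : ℕ) : ZMod m) ∉ B := by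
    -- Walking left from `i` reaches the missing point `y`. The least such walk locates the start of
    -- the run.
    refine ⟨(i - y - 1).val, ?_⟩
    push_cast
    rw [ZMod.natCast_zmod_val]
    convert hy using 2
    ring
  classical
  set d := Nat.find hleft with hd
  set x := i - (d : ZMod m) with hx
  have hright : ∃ s : ℕ, x + (s : ZMod m) ∉ B := by
    refine ⟨(y - x).val, ?_⟩
    rw [ZMod.natCast_zmod_val]
    simpa using hy
  have hlen : Nat.find hright < m := by
    refine lt_of_le_of_lt (Nat.find_min' hright (m := (y - x).val) ?_) (ZMod.val_lt _)
    rw [ZMod.natCast_zmod_val]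
    simpa using hy
  have hbig : d + t ≤ Nat.find hright := by
    by_contra! hlt
    refine Nat.find_spec hright ?_
    generalize Nat.find hright = s at hlt
    rcases lt_or_ge s d with hs | hs
    · have := Nat.find_min hleft (m := d - s - 1) (by omega)
      rw [not_not] at this
      convert this using 1
      rw [show d - s - 1 + 1 = d - s by omega, Nat.cast_sub hs.le, hx]
      ring
    · convert h (s - d) (by omega) using 1
      rw [Nat.cast_sub hs, hx]
      ring
  refine ⟨(x, Nat.find hright), mem_runs.2 ⟨⟨by dsimp only; omega, hlen⟩, ?_, ?_, ?_⟩, d, ?_, hbig⟩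
  · have hspec := Nat.find_spec hleft
    rw [← hd] at hspec
    convert hspec using 2
    push_cast
    rw [hx]
    ring
  · intro j hj
    have := Nat.find_min hright hj
    rwa [not_not] at this
  · exact Nat.find_spec hright
  · exact (sub_add_cancel i _).symm

/-- If `B ⊇ S` has no runs longer than `t` other than those of `S`, then the runs of length `t`
of `S` are runs of `B`. -/
theorem mem_runs_of_subset {S B : Finset (ZMod m)} (hSB : S ⊆ B) (hB : B ≠ Finset.univ)
    {q : ZMod m × ℕ} (hq : q ∈ runs S) (h : ∀ p ∈ runs B, q.2 < p.2 → p ∈ runs S) :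
    q ∈ runs B := by
  have hq0 := mem_runs.1 hq
  obtain ⟨p, hp, d, hd, hle⟩ := exists_run hB hq0.1.1 (fun j hj => hSB (hq0.2.2.1 j hj))
  rcases lt_or_ge q.2 p.2 with hlt | hge
  · rwa [runs_unique hq (h p hp hlt) (d := 0) (d' := d) (by omega) (by omega) (by simpa using hd)]
  · have h0 : d = 0 := by omega
    have : q = p := Prod.ext (by simpa [h0] using hd) (by omega)
    rwa [this]

/-- Let `t` be the largest length whose multiplicities in `S` and `B` differ. The runs longer than
`t` are then the same in both sets, so a run of `S` of length `t` cannot be absorbed by a longer run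
of `B` and survives. Thus `B` has more runs of length `t`, which decides the order. -/
theorem runSequence_mono {S B : Finset (ZMod m)} (hSB : S ⊆ B) :
    runSequence m S ≤ runSequence m B := by
  by_cases hB : B = Finset.univ
  · by_cases hS : S = Finset.univ
    · rw [hS, hB]
    · refine (Multiset.sort_lt_sort_of_forall_lt (b := m) ?_ ?_).le
      · simp [runLengths, hB]
      · intro a ha
        obtain ⟨q, hq, rfl⟩ := (mem_runLengths hS).1 ha
        exact (mem_runs.1 hq).1.2
  have hS : S ≠ Finset.univ := fun h => hB (Finset.univ_subset_iff.1 (h ▸ hSB))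
  by_cases heq : runLengths m S = runLengths m B
  · rw [runSequence, runSequence, heq]
  have hzero : ∀ {A : Finset (ZMod m)}, A ≠ Finset.univ → ∀ a, m ≤ a →
      (runLengths m A).count a = 0 := by
    intro A hA a ha
    refine Multiset.count_eq_zero.2 fun hmem => ?_
    obtain ⟨q, hq, rfl⟩ := (mem_runLengths hA).1 hmem
    have := (mem_runs.1 hq).1.2
    omega
  obtain ⟨a, ha⟩ : ∃ a, (runLengths m S).count a ≠ (runLengths m B).count a := by
    by_contra! h
    exact heq (Multiset.ext.2 h)
  obtain ⟨t, ht, hmax⟩ := ((Finset.range m).filter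
      (fun a => (runLengths m S).count a ≠ (runLengths m B).count a)).exists_max_image id
    ⟨a, by
      simp only [Finset.mem_filter, Finset.mem_range]
      refine ⟨?_, ha⟩
      by_contra! h
      exact ha (by rw [hzero hS a h, hzero hB a h])⟩
  simp only [Finset.mem_filter, Finset.mem_range, id] at ht hmax
  have hgt : ∀ a, t < a → (runLengths m S).count a = (runLengths m B).count a := by
    intro a hta
    by_contra hne
    rcases lt_or_ge a m with h | h
    · have := hmax a ⟨h, hne⟩
      omega
    · exact hne (by rw [hzero hS a h, hzero hB a h])
  -- Downward induction on the run length, with `c` bounding its distance from `m`. Longer runs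
  -- already agree, so the runs of `S` of this length are runs of `B`, and equal counts make the
  -- inclusion an equality.
  have hlong : ∀ c : ℕ, ∀ q : ZMod m × ℕ, t < q.2 → m ≤ q.2 + c → (q ∈ runs B → q ∈ runs S) := by
    intro c
    induction c with
    | zero =>
      intro q _ hm hq
      have := (mem_runs.1 hq).1.2
      omega
    | succ c ih =>
      intro q htq hm hq
      have hsub : (runs S).filter (fun p => p.2 = q.2) ⊆ (runs B).filter (fun p => p.2 = q.2) := by
        intro p hp
        rw [Finset.mem_filter] at hp ⊢
        exact ⟨mem_runs_of_subset hSB hB hp.1 fun p' hp' hlt => ih p' (by omega) (by omega) hp',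
          hp.2⟩
      have hcard := hgt q.2 htq
      rw [count_runLengths hS, count_runLengths hB] at hcard
      have := Finset.eq_of_subset_of_card_le hsub hcard.ge
      have hq' : q ∈ (runs B).filter (fun p => p.2 = q.2) := Finset.mem_filter.2 ⟨hq, rfl⟩
      rw [← this] at hq'
      exact (Finset.mem_filter.1 hq').1
  refine (Multiset.sort_lt_sort_of_count_lt hgt (lt_of_le_of_ne ?_ ht.2)).le
  rw [count_runLengths hS, count_runLengths hB]
  refine Finset.card_le_card fun p hp => ?_
  rw [Finset.mem_filter] at hp ⊢
  exact ⟨mem_runs_of_subset hSB hB hp.1 fun p' hp' hlt => hlong m p' (by omega) (by omega) hp',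
    hp.2⟩

theorem sum_runLengths (S : Finset (ZMod m)) : (runLengths m S).sum = S.card := by
  by_cases hS : S = Finset.univ
  · simp [runLengths, hS, ZMod.card]
  have hunion : S = (runs S).biUnion
      (fun q => (Finset.range q.2).image (fun d : ℕ => q.1 + (d : ZMod m))) := by
    ext x
    simp only [Finset.mem_biUnion, Finset.mem_image, Finset.mem_range]
    constructor
    · intro hx
      obtain ⟨q, hq, d, hd, hle⟩ := exists_run hS (i := x) le_rfl (by simpa using hx)
      exact ⟨q, hq, d, by omega, hd.symm⟩
    · rintro ⟨q, hq, d, hd, rfl⟩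
      exact (mem_runs.1 hq).2.2.1 d hd
  rw [runLengths_of_ne_univ hS]
  conv_rhs => rw [hunion]
  rw [Finset.card_biUnion]
  · refine Finset.sum_congr rfl fun q hq => ?_
    rw [Finset.card_image_of_injOn, Finset.card_range]
    intro a ha b hb hab
    have hm := (mem_runs.1 hq).1.2
    simp only [Finset.coe_range, Set.mem_Iio] at ha hb
    have := congrArg ZMod.val (add_left_cancel hab)
    rwa [ZMod.val_natCast_of_lt (by omega), ZMod.val_natCast_of_lt (by omega)] at this
  · intro q hq q' hq' hne
    rw [Function.onFun, Finset.disjoint_left]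
    simp only [Finset.mem_image, Finset.mem_range]
    rintro x ⟨d, hd, rfl⟩ ⟨d', hd', h⟩
    exact hne (runs_unique hq hq' hd hd' h.symm)

theorem sum_runSequence (S : Finset (ZMod m)) : (runSequence m S).sum = S.card := by
  rw [← sum_runLengths, ← Multiset.sum_coe, runSequence, Multiset.sort_eq]

/-! ### Rotation invariance and dominating sets -/

theorem rotate_compl (c : ZMod m) (S : Finset (ZMod m)) : (rotate c S)ᶜ = rotate c Sᶜ := by
  ext x
  simp

theorem runLengths_rotate (c : ZMod m) (S : Finset (ZMod m)) :
    runLengths m (rotate c S) = runLengths m S := by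
  by_cases hS : S = Finset.univ
  · have : rotate c S = Finset.univ := by
      ext x
      simp [hS]
    rw [this, hS]
  have hS' : rotate c S ≠ Finset.univ := by
    intro h
    refine hS (Finset.eq_univ_of_card _ ?_)
    rw [← card_rotate c, h, Finset.card_univ]
  have hruns : runs (rotate c S) =
      (runs S).map ((Equiv.addRight c).prodCongr (Equiv.refl ℕ)).toEmbedding := by
    ext ⟨x, l⟩
    rw [Finset.mem_map_equiv]
    simp only [mem_runs, mem_rotate, Equiv.prodCongr_symm, Equiv.prodCongr_apply, Prod.map,
      Equiv.addRight_symm, Equiv.coe_addRight, Equiv.refl_symm, Equiv.refl_apply]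
    have h1 : x - 1 - c = x + -c - 1 := by ring
    have h2 : ∀ a : ZMod m, x + a - c = x + -c + a := fun a => by ring
    simp only [h1, h2]
  rw [runLengths_of_ne_univ hS, runLengths_of_ne_univ hS', hruns, Finset.map_val,
    Multiset.map_map]
  rfl

theorem runSequence_rotate (c : ZMod m) (S : Finset (ZMod m)) :
    runSequence m (rotate c S) = runSequence m S := by
  rw [runSequence, runSequence, runLengths_rotate]

theorem runsDominate_rotate {c : ZMod m} {S : Finset (ZMod m)} :
    RunsDominate m (rotate c S) ↔ RunsDominate m S := by
  rw [RunsDominate, RunsDominate, rotate_compl, runSequence_rotate, runSequence_rotate]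

theorem RunsDominate.inter_nonempty {S S' : Finset (ZMod m)} (h : RunsDominate m S)
    (h' : RunsDominate m S') : (S ∩ S').Nonempty := by
  rw [← Finset.not_disjoint_iff_nonempty_inter]
  intro hd
  have h1 : runSequence m S ≤ runSequence m S'ᶜ :=
    runSequence_mono (Finset.subset_compl_iff_disjoint_right.2 hd)
  have h2 : runSequence m S' ≤ runSequence m Sᶜ :=
    runSequence_mono (Finset.subset_compl_iff_disjoint_right.2 hd.symm)
  exact lt_irrefl _ ((h2.trans_lt h).trans_le (h1.trans h'.le))

theorem RunsDominate.compl_of_not {S : Finset (ZMod m)} (hm : Odd m) (h : ¬ RunsDominate m S) :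
    RunsDominate m Sᶜ := by
  rw [RunsDominate, compl_compl]
  -- Equal sequences have equal sums, so `S` would be exactly half of an odd circle.
  refine lt_of_le_of_ne (not_lt.1 h) fun heq => ?_
  have h1 := congrArg List.sum heq
  rw [sum_runSequence, sum_runSequence] at h1
  have h2 := Finset.card_add_card_compl S
  rw [ZMod.card] at h2
  obtain ⟨a, ha⟩ := hm
  omega

theorem RunsDominate.not_compl {S : Finset (ZMod m)} (h : RunsDominate m S) :
    ¬ RunsDominate m Sᶜ := by
  rw [RunsDominate, compl_compl]
  exact h.not_gt

/-- An initial segment covering less than half of the circle does not dominate. -/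
theorem not_runsDominate_of_initial {S : Finset (ZMod m)} (hS : 2 * S.card ≤ m)
    (h : ∀ x ∈ S, ∀ y : ZMod m, y.val < x.val → y ∈ S) : ¬ RunsDominate m S := by
  have hlt : ∀ x ∈ S, x.val < S.card := by
    intro x hx
    have hsub : (Finset.range (x.val + 1)).image (fun a : ℕ => (a : ZMod m)) ⊆ S := by
      intro y hy
      simp only [Finset.mem_image, Finset.mem_range] at hy
      obtain ⟨a, ha, rfl⟩ := hy
      rcases Nat.lt_succ_iff_lt_or_eq.1 ha with h1 | rfl
      · refine h x hx _ ?_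
        rwa [ZMod.val_natCast_of_lt (h1.trans (ZMod.val_lt x))]
      · rwa [ZMod.natCast_zmod_val]
    have hcard := Finset.card_le_card hsub
    rw [Finset.card_image_of_injOn, Finset.card_range] at hcard
    · omega
    · intro a ha b hb hab
      have hm := ZMod.val_lt x
      simp only [Finset.coe_range, Set.mem_Iio] at ha hb
      have := congrArg ZMod.val hab
      dsimp only at this
      rwa [ZMod.val_natCast_of_lt (by omega), ZMod.val_natCast_of_lt (by omega)] at this
  -- `S` is an arc of `S.card` points starting at 0. Rotating it by its own length moves it off
  -- itself, since it covers at most half of the circle.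
  have hsub : rotate (S.card : ZMod m) S ⊆ Sᶜ := by
    intro y hy
    rw [mem_rotate] at hy
    rw [Finset.mem_compl]
    intro hyS
    have h1 := hlt _ hy
    have h2 := hlt _ hyS
    have h3 : y = ((y - (S.card : ZMod m)).val + S.card : ℕ) := by
      push_cast
      rw [ZMod.natCast_zmod_val]
      ring
    rw [h3, ZMod.val_natCast_of_lt (by omega)] at h2
    omega
  have := runSequence_mono hsub
  rw [runSequence_rotate] at this
  exact this.not_gt

/-- A set with three consecutive elements that meets every arc of three points dominates. -/
theorem runsDominate_of_arc {S : Finset (ZMod m)} (hS : S ≠ Finset.univ) {i : ZMod m}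
    (h1 : ∀ j < 3, i + ((j : ℕ) : ZMod m) ∈ S)
    (h2 : ∀ x : ZMod m, ∃ j < 3, x + ((j : ℕ) : ZMod m) ∈ S) : RunsDominate m S := by
  have hSc : Sᶜ ≠ Finset.univ := by
    intro h
    have := Finset.mem_univ (i + ((0 : ℕ) : ZMod m))
    rw [← h, Finset.mem_compl] at this
    exact this (h1 0 (by norm_num))
  -- The longest run of ones has length at least 3, and every run of zeros has length at most 2.
  obtain ⟨q, hq, d, -, hle⟩ := exists_run hS (by norm_num) h1
  refine Multiset.sort_lt_sort_of_forall_lt ((mem_runLengths hS).2 ⟨q, hq, rfl⟩) fun a ha => ?_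
  obtain ⟨p, hp, rfl⟩ := (mem_runLengths hSc).1 ha
  obtain ⟨j, hj, hmem⟩ := h2 p.1
  by_contra! hlt
  exact Finset.mem_compl.1 ((mem_runs.1 hp).2.2.1 j (by omega)) hmem

end Runs

/-! ### Binomial inequalities -/

theorem Nat.choose_lt_choose_of_two_mul_le {M b c : ℕ} (hbc : b < c) (hc : 2 * c ≤ M) :
    M.choose b < M.choose c := by
  induction c, hbc using Nat.le_induction with
  | base =>
    have h := Nat.choose_succ_right_eq M b
    have hpos : 0 < M.choose b := Nat.choose_pos (by omega)
    by_contra! hle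
    have h1 : M.choose (b + 1) * (b + 1) ≤ M.choose b * (b + 1) := Nat.mul_le_mul_right _ hle
    rw [h] at h1
    have := Nat.le_of_mul_le_mul_left h1 hpos
    omega
  | succ c hbc ih =>
    refine (ih (by omega)).trans_le ?_
    exact Nat.choose_le_succ_of_lt_half_left (by omega)

/-- By unimodality: if `a` is past the middle, it reflects to `M - a`, which still exceeds `b`. -/
theorem Nat.choose_lt_choose_of_add_lt {M a b : ℕ} (hba : b < a) (h : a + b < M) :
    M.choose b < M.choose a := by
  rcases le_or_gt (2 * a) M with h2 | h2
  · exact Nat.choose_lt_choose_of_two_mul_le hba h2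
  · rw [← Nat.choose_symm (show a ≤ M by omega)]
    exact Nat.choose_lt_choose_of_two_mul_le (by omega) (by omega)

/-! ### Averaging over the circle and comparing weights -/

section CircleSums

variable {m : ℕ} [NeZero m]

/-- For a rotation invariant collection of subsets of the circle, the weight of the sets avoiding
a point does not depend on the point. -/
theorem mul_sum_avoiding (P : Finset (ZMod m) → Prop) [DecidablePred P]
    (hP : ∀ c S, P (rotate c S) ↔ P S) (f : ℕ → ℕ) (x : ZMod m) :
    m * ∑ S with P S ∧ x ∉ S, f S.card = ∑ S with P S, (m - S.card) * f S.card := by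
  have hconst : ∀ y : ZMod m,
      ∑ S with P S ∧ y ∉ S, f S.card = ∑ S with P S ∧ x ∉ S, f S.card := by
    intro y
    refine Finset.sum_nbij' (rotate (x - y)) (rotate (y - x)) ?_ ?_ ?_ ?_ ?_
    · intro S hS
      simpa [hP] using hS
    · intro S hS
      simpa [hP] using hS
    · intro S _
      ext z
      rw [mem_rotate, mem_rotate, sub_sub, sub_add_sub_cancel, sub_self, sub_zero]
    · intro S _
      ext z
      rw [mem_rotate, mem_rotate, sub_sub, sub_add_sub_cancel, sub_self, sub_zero]
    · intro S _
      simp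
  -- Double count the pairs of a set and a point it avoids.
  calc m * ∑ S with P S ∧ x ∉ S, f S.card
      = ∑ y : ZMod m, ∑ S with P S ∧ y ∉ S, f S.card := by
        simp [hconst, ZMod.card]
    _ = ∑ y : ZMod m, ∑ S with P S, if y ∉ S then f S.card else 0 := by
        refine Finset.sum_congr rfl fun y _ => ?_
        rw [← Finset.filter_filter, Finset.sum_filter]
    _ = ∑ S with P S, (m - S.card) * f S.card := by
        rw [Finset.sum_comm]
        refine Finset.sum_congr rfl fun S _ => ?_
        rw [← Finset.sum_filter, Finset.sum_const, smul_eq_mul]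
        congr 1
        rw [← Finset.compl_filter, Finset.card_compl, ZMod.card]
        simp

end CircleSums

/-- Some set of at most half of the points of the circle dominates: its ones and zeros follow the
pattern `11100100100` continued by copies of `10`. -/
theorem exists_runsDominate_card_le {r : ℕ} (hr : 5 ≤ r) :
    ∃ S : Finset (ZMod (2 * r + 1)), S.card ≤ r ∧ RunsDominate (2 * r + 1) S := by
  have hval : ∀ a : ℕ, a < 2 * r + 1 → ((a : ZMod (2 * r + 1))).val = a :=
    fun a ha => ZMod.val_natCast_of_lt ha
  let p : ℕ → Prop := fun v => v < 3 ∨ v = 5 ∨ v = 8 ∨ (11 ≤ v ∧ v % 2 = 1)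
  let S : Finset (ZMod (2 * r + 1)) := Finset.univ.filter fun x => p x.val
  have hmem : ∀ a : ℕ, a < 2 * r + 1 → ((a : ZMod (2 * r + 1)) ∈ S ↔ p a) := by
    intro a ha
    simp [S, hval a ha]
  have hmod : ∀ a : ℕ, 2 * r + 1 ≤ a → a < 2 * r + 4 → (a : ZMod (2 * r + 1)) ∈ S := by
    intro a ha ha'
    have : (a : ZMod (2 * r + 1)) = ((a - (2 * r + 1) : ℕ) : ZMod (2 * r + 1)) := by
      rw [Nat.cast_sub ha, ZMod.natCast_self, sub_zero]
    rw [this, hmem _ (by omega)]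
    left
    omega
  refine ⟨S, ?_, runsDominate_of_arc (i := 0) ?_ ?_ ?_⟩
  -- Five points below 11 and the `r - 5` odd numbers from 11 to `2 * r - 1` make `r` in all.
  · have hsub : S ⊆ (insert 0 (insert 1 (insert 2 (insert 5 (insert 8
        ((Finset.Ico 5 r).image fun a => 2 * a + 1)))))).image
        (fun a : ℕ => (a : ZMod (2 * r + 1))) := by
      intro x hx
      simp only [S, p, Finset.mem_filter, Finset.mem_univ, true_and] at hx
      refine Finset.mem_image.2 ⟨x.val, ?_, ZMod.natCast_zmod_val x⟩
      simp only [Finset.mem_insert, Finset.mem_image, Finset.mem_Ico]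
      have := ZMod.val_lt x
      by_cases h : 11 ≤ x.val
      · refine Or.inr (Or.inr (Or.inr (Or.inr (Or.inr ⟨x.val / 2, ?_, ?_⟩)))) <;> omega
      · omega
    refine (Finset.card_le_card hsub).trans (Finset.card_image_le.trans ?_)
    have h1 := Finset.card_image_le (s := Finset.Ico 5 r) (f := fun a => 2 * a + 1)
    rw [Nat.card_Ico] at h1
    have h2 := fun (a : ℕ) (s : Finset ℕ) => Finset.card_insert_le a s
    refine (h2 _ _).trans ?_
    have := (h2 1 _).trans (Nat.add_le_add_right ((h2 2 _).trans (Nat.add_le_add_right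
      ((h2 5 _).trans (Nat.add_le_add_right ((h2 8 _).trans
        (Nat.add_le_add_right h1 1)) 1)) 1)) 1)
    omega
  · intro h
    have := (hmem 3 (by omega)).1 (h ▸ Finset.mem_univ _)
    simp only [p] at this
    omega
  · intro j hj
    rw [zero_add, hmem j (by omega)]
    exact Or.inl hj
  · intro x
    have hx := ZMod.val_lt x
    have key : ∀ j : ℕ, x + (j : ZMod (2 * r + 1)) = ((x.val + j : ℕ) : ZMod (2 * r + 1)) := by
      intro j
      rw [Nat.cast_add, ZMod.natCast_zmod_val]
    simp only [key]
    -- A window running past `2 * r` wraps around to the initial `111`.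
    obtain ⟨j, hj, h⟩ : ∃ j < 3, 2 * r + 1 ≤ x.val + j ∨ p (x.val + j) := by
      by_cases h0 : 2 * r + 1 ≤ x.val + 0 ∨ p (x.val + 0)
      · exact ⟨0, by norm_num, h0⟩
      by_cases h1 : 2 * r + 1 ≤ x.val + 1 ∨ p (x.val + 1)
      · exact ⟨1, by norm_num, h1⟩
      refine ⟨2, by norm_num, ?_⟩
      simp only [p] at h0 h1 ⊢
      omega
    refine ⟨j, hj, ?_⟩
    by_cases hlt : x.val + j < 2 * r + 1
    · exact (hmem _ hlt).2 (h.resolve_left (by omega))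
    · exact hmod _ (by omega) (by omega)

/-- A weight that decreases under complementation of large sets gives the dominating sets more
total weight than the large sets. -/
theorem sum_large_lt_sum_runsDominate {r : ℕ} (hr : 5 ≤ r) {h : ℕ → ℕ}
    (hh : ∀ j, r + 1 ≤ j → j ≤ 2 * r + 1 → h j < h (2 * r + 1 - j)) :
    ∑ S : Finset (ZMod (2 * r + 1)) with r + 1 ≤ S.card, h S.card <
      ∑ S : Finset (ZMod (2 * r + 1)) with RunsDominate (2 * r + 1) S, h S.card := by
  have hcompl : ∀ S : Finset (ZMod (2 * r + 1)), Sᶜ.card = 2 * r + 1 - S.card := by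
    intro S
    rw [Finset.card_compl, ZMod.card]
  have hle : ∀ S : Finset (ZMod (2 * r + 1)), S.card ≤ 2 * r + 1 := by
    intro S
    simpa [ZMod.card] using Finset.card_le_univ S
  rw [← Finset.sum_sdiff_lt_sum_sdiff]
  set D := Finset.univ.filter fun S : Finset (ZMod (2 * r + 1)) => r + 1 ≤ S.card
  set T := Finset.univ.filter fun S : Finset (ZMod (2 * r + 1)) => RunsDominate (2 * r + 1) S
  obtain ⟨S₀, hS₀, hS₀'⟩ := exists_runsDominate_card_le hr
  -- Complementation maps the large non-dominating sets injectively to small dominating ones and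
  -- raises their weight. The complement of `S₀` makes the inequality strict.
  calc ∑ S ∈ D \ T, h S.card < ∑ S ∈ D \ T, h Sᶜ.card := by
        refine Finset.sum_lt_sum_of_nonempty ⟨S₀ᶜ, ?_⟩ fun S hS => ?_
        · simp only [D, T, Finset.mem_sdiff, Finset.mem_filter, Finset.mem_univ, true_and]
          refine ⟨?_, hS₀'.not_compl⟩
          rw [hcompl]
          omega
        · simp only [D, T, Finset.mem_sdiff, Finset.mem_filter, Finset.mem_univ, true_and] at hS
          rw [hcompl]
          exact hh _ hS.1 (hle S)
    _ = ∑ S ∈ (D \ T).image compl, h S.card := by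
        rw [Finset.sum_image compl_injective.injOn]
    _ ≤ ∑ S ∈ T \ D, h S.card := by
        refine Finset.sum_le_sum_of_subset fun S hS => ?_
        obtain ⟨A, hA, rfl⟩ := Finset.mem_image.1 hS
        simp only [D, T, Finset.mem_sdiff, Finset.mem_filter, Finset.mem_univ, true_and] at hA ⊢
        refine ⟨RunsDominate.compl_of_not ⟨r, rfl⟩ hA.2, ?_⟩
        rw [hcompl]
        omega

/-! ### From traces to families of `k`-sets -/

section Juntas

variable {n k r : ℕ}

theorem mem_circleTrace {A : Finset (Fin n)} {x : ZMod (2 * r + 1)} :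
    x ∈ circleTrace r A ↔ ∃ i ∈ A, (i : ℕ) = x.val := by
  simp [circleTrace]

theorem natCast_mem_circleTrace {A : Finset (Fin n)} {i : Fin n} (hi : (i : ℕ) < 2 * r + 1) :
    ((i : ℕ) : ZMod (2 * r + 1)) ∈ circleTrace r A ↔ i ∈ A := by
  rw [mem_circleTrace, ZMod.val_natCast_of_lt hi]
  constructor
  · rintro ⟨j, hj, h⟩
    rwa [← Fin.ext h]
  · exact fun h => ⟨i, h, rfl⟩

theorem card_circleTrace (A : Finset (Fin n)) :
    (circleTrace r A).card = (A.filter fun i : Fin n => (i : ℕ) < 2 * r + 1).card := by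
  symm
  refine Finset.card_bij (fun i _ => ((i : ℕ) : ZMod (2 * r + 1))) ?_ ?_ ?_
  · intro i hi
    rw [Finset.mem_filter] at hi
    exact (natCast_mem_circleTrace hi.2).2 hi.1
  · intro i hi j hj h
    rw [Finset.mem_filter] at hi hj
    have := congrArg ZMod.val h
    rw [ZMod.val_natCast_of_lt hi.2, ZMod.val_natCast_of_lt hj.2] at this
    exact Fin.ext this
  · intro x hx
    obtain ⟨i, hi, h⟩ := mem_circleTrace.1 hx
    exact ⟨i, Finset.mem_filter.2 ⟨hi, h ▸ ZMod.val_lt x⟩, by rw [h, ZMod.natCast_zmod_val]⟩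

/-- The subset of `[n]` corresponding to a subset of the circle. -/
def circleLift (n : ℕ) (S : Finset (ZMod (2 * r + 1))) : Finset (Fin n) :=
  Finset.univ.filter fun i => (i : ℕ) < 2 * r + 1 ∧ ((i : ℕ) : ZMod (2 * r + 1)) ∈ S

theorem mem_circleLift {S : Finset (ZMod (2 * r + 1))} {i : Fin n} :
    i ∈ circleLift n S ↔ (i : ℕ) < 2 * r + 1 ∧ ((i : ℕ) : ZMod (2 * r + 1)) ∈ S := by
  simp [circleLift]

theorem circleLift_circleTrace (A : Finset (Fin n)) :
    circleLift n (circleTrace r A) = A.filter fun i : Fin n => (i : ℕ) < 2 * r + 1 := by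
  ext i
  rw [mem_circleLift, Finset.mem_filter, and_comm]
  exact and_congr_left natCast_mem_circleTrace

theorem circleTrace_union_circleLift (hn : 2 * r + 1 ≤ n) (S : Finset (ZMod (2 * r + 1)))
    {B : Finset (Fin n)} (hB : ∀ i ∈ B, 2 * r + 1 ≤ (i : ℕ)) :
    circleTrace r (circleLift n S ∪ B) = S := by
  ext x
  have hx := ZMod.val_lt x
  rw [mem_circleTrace]
  constructor
  · rintro ⟨i, hi, h⟩
    rcases Finset.mem_union.1 hi with hi | hi
    · have := (mem_circleLift.1 hi).2
      rwa [h, ZMod.natCast_zmod_val] at this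
    · have := hB i hi
      omega
  · intro h
    refine ⟨⟨x.val, by omega⟩, Finset.mem_union_left _ (mem_circleLift.2 ⟨hx, ?_⟩), rfl⟩
    rwa [ZMod.natCast_zmod_val]

theorem card_circleLift (hn : 2 * r + 1 ≤ n) (S : Finset (ZMod (2 * r + 1))) :
    (circleLift n S).card = S.card := by
  have h := card_circleTrace (r := r) (circleLift n S)
  have h2 := circleTrace_union_circleLift hn S (B := ∅) (by simp)
  rw [Finset.union_empty] at h2
  rw [h2] at h
  rw [h, Finset.filter_true_of_mem]
  exact fun i hi => (mem_circleLift.1 hi).1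

/-- The elements of `[n]` outside the circle. -/
def offCircle (n r : ℕ) : Finset (Fin n) :=
  Finset.univ.filter fun i => 2 * r + 1 ≤ (i : ℕ)

theorem mem_offCircle {i : Fin n} : i ∈ offCircle n r ↔ 2 * r + 1 ≤ (i : ℕ) := by
  simp [offCircle]

theorem card_offCircle (hn : 2 * r + 1 ≤ n) : (offCircle n r).card = n - (2 * r + 1) := by
  have h : offCircle n r = (circleLift n (Finset.univ : Finset (ZMod (2 * r + 1))))ᶜ := by
    ext i
    simp [mem_offCircle, mem_circleLift]
  rw [h, Finset.card_compl, card_circleLift hn, Finset.card_univ, ZMod.card, Fintype.card_fin]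

/-- The number of `k`-sets with a given trace that avoid a point not lifted from the trace. -/
theorem card_trace_eq_avoiding (hn : 2 * r + 1 ≤ n) {S : Finset (ZMod (2 * r + 1))}
    (hk : S.card ≤ k) {i : Fin n} (hi : i ∉ circleLift n S) :
    ((Finset.powersetCard k (Finset.univ : Finset (Fin n))).filter
      fun A => circleTrace r A = S ∧ i ∉ A).card =
      ((offCircle n r).erase i).card.choose (k - S.card) := by
  rw [← Finset.card_powersetCard]
  have hdisj : ∀ B ⊆ (offCircle n r).erase i, Disjoint (circleLift n S) B := by
    intro B hB
    rw [Finset.disjoint_left]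
    intro j hj hjB
    have h1 := (mem_circleLift.1 hj).1
    have h2 := mem_offCircle.1 (Finset.mem_of_mem_erase (hB hjB))
    omega
  refine Finset.card_nbij' (fun A => A \ circleLift n S) (fun B => circleLift n S ∪ B)
    ?_ ?_ ?_ ?_
  · intro A hA
    simp only [Finset.coe_filter, Set.mem_ofPred_eq, Finset.mem_powersetCard,
      Finset.subset_univ, true_and] at hA
    obtain ⟨hAk, rfl, hiA⟩ := hA
    simp only [Finset.mem_coe, Finset.mem_powersetCard, circleLift_circleTrace]
    constructor
    · intro j hj
      rw [Finset.mem_sdiff, Finset.mem_filter] at hj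
      refine Finset.mem_erase.2 ⟨fun h => hiA (h ▸ hj.1), mem_offCircle.2 ?_⟩
      by_contra! hlt
      exact hj.2 ⟨hj.1, hlt⟩
    · rw [Finset.card_sdiff_of_subset (Finset.filter_subset _ _), hAk, card_circleTrace]
  · intro B hB
    rw [Finset.mem_coe, Finset.mem_powersetCard] at hB
    simp only [Finset.coe_filter, Set.mem_ofPred_eq, Finset.mem_powersetCard,
      Finset.subset_univ, true_and]
    refine ⟨?_, circleTrace_union_circleLift hn S fun j hj =>
      mem_offCircle.1 (Finset.mem_of_mem_erase (hB.1 hj)), ?_⟩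
    · rw [Finset.card_union_of_disjoint (hdisj B hB.1), card_circleLift hn, hB.2]
      omega
    · rw [Finset.mem_union]
      rintro (h | h)
      · exact hi h
      · exact Finset.notMem_erase _ _ (hB.1 h)
  · intro A hA
    simp only [Finset.coe_filter, Set.mem_ofPred_eq, Finset.mem_powersetCard,
      Finset.subset_univ, true_and] at hA
    obtain ⟨-, rfl, -⟩ := hA
    refine Finset.union_sdiff_of_subset ?_
    rw [circleLift_circleTrace]
    exact Finset.filter_subset _ _
  · intro B hB
    rw [Finset.mem_coe, Finset.mem_powersetCard] at hB
    exact Finset.union_sdiff_cancel_left (hdisj B hB.1)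

/-- Sort the members by trace. The bound `2 * r + 1 ≤ k` keeps `k - S.card` from truncating. -/
theorem card_junta_avoiding (hn : 2 * r + 1 ≤ n) (hk : 2 * r + 1 ≤ k)
    (P : Finset (ZMod (2 * r + 1)) → Prop) [DecidablePred P] (i : Fin n) :
    (((Finset.powersetCard k (Finset.univ : Finset (Fin n))).filter
      fun A => P (circleTrace r A)).filter fun A => i ∉ A).card =
      ∑ S with P S ∧ i ∉ circleLift n S,
        ((offCircle n r).erase i).card.choose (k - S.card) := by
  rw [Finset.card_eq_sum_card_fiberwise (f := circleTrace r)
    (t := Finset.univ.filter fun S => P S ∧ i ∉ circleLift n S)]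
  · refine Finset.sum_congr rfl fun S hS => ?_
    simp only [Finset.mem_filter, Finset.mem_univ, true_and] at hS
    have hSk : S.card ≤ k := by
      have := Finset.card_le_univ S
      rw [ZMod.card] at this
      omega
    rw [← card_trace_eq_avoiding hn hSk hS.2, Finset.filter_filter, Finset.filter_filter]
    congr 1
    refine Finset.filter_congr fun A _ => ?_
    constructor
    · rintro ⟨-, h1, h2⟩
      exact ⟨h2, h1⟩
    · rintro ⟨rfl, h⟩
      exact ⟨hS.1, h, rfl⟩
  · intro A hA
    simp only [Finset.coe_filter, Finset.mem_filter, Set.mem_ofPred_eq, Finset.mem_univ,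
      true_and] at hA ⊢
    refine ⟨hA.1.2, fun h => hA.2 ?_⟩
    rw [circleLift_circleTrace] at h
    exact (Finset.mem_filter.1 h).1

theorem familyD_eq_junta (n k r : ℕ) :
    familyD n k r = (Finset.powersetCard k (Finset.univ : Finset (Fin n))).filter
      fun A => r + 1 ≤ (circleTrace r A).card := by
  simp only [familyD, card_circleTrace]

theorem degree_add_card_avoiding (F : Finset (Finset (Fin n))) (i : Fin n) :
    degree F i + (F.filter fun A => i ∉ A).card = F.card :=
  Finset.card_filter_add_card_filter_not _

theorem diversity_le_card_avoiding (F : Finset (Finset (Fin n))) (i : Fin n) :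
    diversity F ≤ (F.filter fun A => i ∉ A).card := by
  have h1 := degree_add_card_avoiding F i
  have h2 : degree F i ≤ maxDegree F := Finset.le_sup (Finset.mem_univ i)
  rw [diversity]
  omega

theorem exists_diversity_eq_card_avoiding (hn : 0 < n) (F : Finset (Finset (Fin n))) :
    ∃ i, diversity F = (F.filter fun A => i ∉ A).card := by
  obtain ⟨i, -, hi⟩ := Finset.exists_mem_eq_sup Finset.univ ⟨⟨0, hn⟩, Finset.mem_univ _⟩ (degree F)
  refine ⟨i, ?_⟩
  have h := degree_add_card_avoiding F i
  rw [diversity, maxDegree, hi]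
  omega

/-- Every point is avoided by more members of `familyT` than of `familyD`. -/
theorem card_familyD_avoiding_lt (hr : 5 ≤ r) (hk : 2 * r + 1 ≤ k) (hn : 2 * k + 2 ≤ n)
    (i : Fin n) :
    ((familyD n k r).filter fun A => i ∉ A).card <
      ((familyT n k r).filter fun A => i ∉ A).card := by
  have hrn : 2 * r + 1 ≤ n := by omega
  -- The two lower indices add up to `2 * k - (2 * r + 1)`, which is less than `n - (2 * r + 1) - 1`
  -- exactly because `2 * k + 2 ≤ n`.
  have hchoose : ∀ M, n - (2 * r + 1) - 1 ≤ M → ∀ j, r + 1 ≤ j → j ≤ 2 * r + 1 →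
      M.choose (k - j) < M.choose (k - (2 * r + 1 - j)) := fun M hM j h1 h2 =>
    Nat.choose_lt_choose_of_add_lt (by omega) (by omega)
  rw [familyD_eq_junta, familyT, card_junta_avoiding hrn hk (RunsDominate (2 * r + 1)),
    card_junta_avoiding hrn hk fun S => r + 1 ≤ S.card]
  by_cases hi : (i : ℕ) < 2 * r + 1
  · have hmem : ∀ S : Finset (ZMod (2 * r + 1)),
        i ∉ circleLift n S ↔ ((i : ℕ) : ZMod (2 * r + 1)) ∉ S := by
      intro S
      simp [mem_circleLift, hi]
    have hoff : i ∉ offCircle n r := by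
      rw [mem_offCircle]
      omega
    simp only [hmem]
    -- Multiplying by the length of the circle makes the averaging identity applicable to both
    -- sides.
    rw [Finset.erase_eq_of_notMem hoff, card_offCircle hrn,
      ← Nat.mul_lt_mul_left (Nat.succ_pos (2 * r)),
      mul_sum_avoiding (fun S : Finset (ZMod (2 * r + 1)) => r + 1 ≤ S.card) (by simp)
        (fun j => (n - (2 * r + 1)).choose (k - j)),
      mul_sum_avoiding (RunsDominate (2 * r + 1)) (fun c S => runsDominate_rotate)
        (fun j => (n - (2 * r + 1)).choose (k - j))]
    refine sum_large_lt_sum_runsDominate hr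
      (h := fun j => (2 * r + 1 - j) * (n - (2 * r + 1)).choose (k - j)) fun j h1 h2 => ?_
    exact Nat.mul_lt_mul_of_le_of_lt (by omega) (hchoose _ (by omega) j h1 h2) (by omega)
  · have hmem : ∀ S : Finset (ZMod (2 * r + 1)), i ∉ circleLift n S := by
      intro S
      simp [mem_circleLift, hi]
    have hoff : i ∈ offCircle n r := by
      rw [mem_offCircle]
      omega
    simp only [hmem, not_false_eq_true, and_true]
    rw [Finset.card_erase_of_mem hoff, card_offCircle hrn]
    exact sum_large_lt_sum_runsDominate hr
      (h := fun j => (n - (2 * r + 1) - 1).choose (k - j)) (hchoose _ le_rfl)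

theorem diversity_familyD_lt (hr : 5 ≤ r) (hk : 2 * r + 1 ≤ k) (hn : 2 * k + 2 ≤ n) :
    diversity (familyD n k r) < diversity (familyT n k r) := by
  -- The point `i` has maximal degree in `familyT`; any point bounds the diversity of `familyD` from
  -- above.
  obtain ⟨i, hi⟩ := exists_diversity_eq_card_avoiding (by omega) (familyT n k r)
  rw [hi]
  exact (diversity_le_card_avoiding _ i).trans_lt (card_familyD_avoiding_lt hr hk hn i)

theorem isIntersectingFamily_familyT (n k r : ℕ) : IsIntersectingFamily (familyT n k r) := by
  intro A hA B hB
  obtain ⟨x, hx⟩ := (Finset.mem_filter.1 hA).2.inter_nonempty (Finset.mem_filter.1 hB).2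
  rw [Finset.mem_inter, mem_circleTrace, mem_circleTrace] at hx
  obtain ⟨⟨i, hi, h⟩, j, hj, h'⟩ := hx
  have hij : j = i := Fin.ext (h'.trans h.symm)
  exact ⟨i, Finset.mem_inter.2 ⟨hi, hij ▸ hj⟩⟩

theorem exists_mem_familyT_card_le (hr : 5 ≤ r) (hk : r ≤ k) (hn : 2 * r + 1 + k ≤ n) :
    ∃ A ∈ familyT n k r, (circleTrace r A).card ≤ r := by
  obtain ⟨S, hS, hdom⟩ := exists_runsDominate_card_le hr
  obtain ⟨B, hB, hBk⟩ := Finset.exists_subset_card_eq (s := offCircle n r) (n := k - S.card) (by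
    rw [card_offCircle (by omega)]
    omega)
  have htr := circleTrace_union_circleLift (by omega) S fun j hj => mem_offCircle.1 (hB hj)
  refine ⟨circleLift n S ∪ B, Finset.mem_filter.2 ⟨?_, htr.symm ▸ hdom⟩, htr.symm ▸ hS⟩
  rw [Finset.mem_powersetCard]
  refine ⟨Finset.subset_univ _, ?_⟩
  rw [Finset.card_union_of_disjoint, card_circleLift (by omega), hBk]
  · omega
  · rw [Finset.disjoint_left]
    intro j hj hjB
    have h1 := (mem_circleLift.1 hj).1
    have h2 := mem_offCircle.1 (hB hjB)
    omega

theorem IsShiftedFamily.shiftSet_mem {F : Finset (Finset (Fin n))} (hF : IsShiftedFamily F)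
    {i j : Fin n} (hij : i < j) {A : Finset (Fin n)} (hA : A ∈ F) : shiftSet i j A ∈ F := by
  rw [← hF i j hij]
  exact Finset.mem_union_left _ (Finset.mem_image_of_mem _ hA)

/-- Among members with trace of size at most `r`, take one with the least sum of elements. Any gap
below an element of its trace would allow a shift to a smaller such member, so the trace is an
initial segment, which cannot dominate. -/
theorem not_isShiftedFamily_familyT (hr : 5 ≤ r) (hk : r ≤ k) (hn : 2 * r + 1 + k ≤ n) :
    ¬ IsShiftedFamily (familyT n k r) := by
  intro hF
  obtain ⟨A₀, hA₀, hA₀'⟩ := exists_mem_familyT_card_le hr hk hn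
  obtain ⟨A, hA, hmin⟩ := ((familyT n k r).filter
    fun A => (circleTrace r A).card ≤ r).exists_min_image (fun A => ∑ i ∈ A, (i : ℕ))
      ⟨A₀, Finset.mem_filter.2 ⟨hA₀, hA₀'⟩⟩
  obtain ⟨hAT, hAr⟩ := Finset.mem_filter.1 hA
  refine not_runsDominate_of_initial (by omega) ?_ (Finset.mem_filter.1 hAT).2
  intro x hx y hyx
  by_contra hy
  have hxr := ZMod.val_lt x
  obtain ⟨j, hj, hjx⟩ := mem_circleTrace.1 hx
  let i : Fin n := ⟨y.val, by omega⟩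
  have hi : i ∉ A := fun h => hy (mem_circleTrace.2 ⟨i, h, rfl⟩)
  have hij : i < j := by
    rw [Fin.lt_def, hjx]
    exact hyx
  have hmem := hF.shiftSet_mem hij hAT
  have hshift : shiftSet i j A = insert i (A.erase j) := if_pos ⟨hj, hi⟩
  rw [hshift] at hmem
  have hi' : i ∉ A.erase j := fun h => hi (Finset.mem_of_mem_erase h)
  have hcard : (circleTrace r (insert i (A.erase j))).card ≤ r := by
    rw [card_circleTrace] at hAr ⊢
    rw [Finset.filter_insert, Finset.filter_erase]
    have hjA : j ∈ A.filter fun i : Fin n => (i : ℕ) < 2 * r + 1 :=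
      Finset.mem_filter.2 ⟨hj, by omega⟩
    have h1 := Finset.card_erase_add_one hjA
    split_ifs
    · exact (Finset.card_insert_le _ _).trans (by omega)
    · omega
  have hle := hmin _ (Finset.mem_filter.2 ⟨hmem, hcard⟩)
  rw [Finset.sum_insert hi', ← Finset.add_sum_erase A _ hj] at hle
  have : (i : ℕ) < (j : ℕ) := hij
  omega

end Juntas

/-! ### The parameter ranges and the conclusion -/

/-- The lower endpoint is `2k - 1 + (k - 1)/(s + 1)`, and the last term is at least 3 for such `k`.
-/
theorem InAKRange.two_mul_add_two_le {n k s r : ℕ} (h : InAKRange n k s) (hsr : s ≤ r)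
    (hk : 3 * (r + 1) + 1 ≤ k) : 2 * k + 2 ≤ n := by
  have h1 := h.1
  have hs : (0 : ℝ) < (s : ℝ) + 1 := by positivity
  have hk' : 3 * ((s : ℝ) + 1) ≤ (k : ℝ) - 1 := by
    have : 3 * (s + 1) + 1 ≤ k := by omega
    have : ((3 * (s + 1) + 1 : ℕ) : ℝ) ≤ k := by exact_mod_cast this
    push_cast at this
    linarith
  have h2 : 3 ≤ ((k : ℝ) - 1) * (1 / ((s : ℝ) + 1)) := by
    rw [mul_one_div, le_div_iff₀ hs]
    exact hk'
  have h3 : 2 * (k : ℝ) + 2 ≤ n := by linarith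
  exact_mod_cast h3

/-- The lower endpoint of the range with index `s`, where it is an integer. -/
theorem inAKRange_lower (K s : ℕ) : InAKRange (K * (2 * s + 3) + 1) (K * (s + 1) + 1) s := by
  have hs : (0 : ℝ) < (s : ℝ) + 1 := by positivity
  have hlow : (((K * (s + 1) + 1 : ℕ) : ℝ) - 1) * (2 + 1 / ((s : ℝ) + 1)) + 1 =
      ((K * (2 * s + 3) + 1 : ℕ) : ℝ) := by
    push_cast
    field_simp
    ring
  refine ⟨hlow.le, ?_⟩
  rcases Nat.eq_zero_or_pos s with h0 | h0
  · exact Or.inl h0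
  · refine Or.inr ?_
    rw [← hlow]
    have hs0 : (0 : ℝ) < s := by exact_mod_cast h0
    have hk : (0 : ℝ) ≤ ((K * (s + 1) + 1 : ℕ) : ℝ) - 1 := by
      push_cast
      rw [add_sub_cancel_right]
      positivity
    gcongr
    linarith

theorem familyT_spec {n k r s : ℕ} (hr : 5 ≤ r) (hk : 3 * (r + 1) + 1 ≤ k)
    (hs : s = r ∨ s + 1 = r) (h : InAKRange n k s) :
    IsIntersectingFamily (familyT n k r) ∧ ¬ IsShiftedFamily (familyT n k r) ∧
      diversity (familyD n k r) < diversity (familyT n k r) := by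
  have hn := h.two_mul_add_two_le (r := r) (by omega) hk
  exact ⟨isIntersectingFamily_familyT n k r,
    not_isShiftedFamily_familyT hr (by omega) (by omega),
    diversity_familyD_lt hr (by omega) hn⟩

theorem not_naiveConjecture {d : ℕ} (hd : d = 0 ∨ d = 1) : ¬ NaiveConjecture d := by
  intro hconj
  -- The counterexample is k = 31, n = 66, at the lower endpoint for s = 5. The index `5 + d` is `s`
  -- or `s + 1`, so both values of `d` are covered.
  have hT := familyT_spec (n := 5 * (2 * 5 + 3) + 1) (k := 5 * (5 + 1) + 1) (r := 5 + d) (s := 5)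
    (by omega) (by omega) (by omega) (inAKRange_lower 5 5)
  refine (hconj _ _ _ (by norm_num) (by norm_num) (by norm_num) (inAKRange_lower 5 5) _ ?_
    hT.1).not_gt hT.2.2
  intro A hA
  exact (Finset.mem_powersetCard.1 (Finset.mem_filter.1 hA).1).2

theorem mainTheorem2 :
    (∃ r₀ : ℕ, ∀ r : ℕ, r₀ ≤ r → ∃ k₀ n₀ : ℕ, ∀ k n : ℕ, k₀ ≤ k → n₀ ≤ n →
      (∃ s : ℕ, (s = r ∨ s + 1 = r) ∧ InAKRange n k s) →
        IsIntersectingFamily (familyT n k r) ∧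
        ¬ IsShiftedFamily (familyT n k r) ∧
        diversity (familyD n k r) < diversity (familyT n k r)) ∧
    ¬ NaiveConjecture 0 ∧
    ¬ NaiveConjecture 1 :=
  -- No separate bound on `n` is needed: the range forces `n ≥ 2k + 2` once `k` is large.
  ⟨⟨5, fun r hr => ⟨3 * (r + 1) + 1, 0, fun _ _ hk _ ⟨_, hs, h⟩ => familyT_spec hr hk hs h⟩⟩,
    not_naiveConjecture (Or.inl rfl), not_naiveConjecture (Or.inr rfl)⟩
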